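/- \textbf{Definitions.} For pseudo-metric spaces $(Z_n,d_n)_{n\in\mathbb N}$ and $p\ge 1$, let $E((Z_n)_{n};p)$ be the equivalence relation on $\prod_n Z_n$ given by $x\mathrel{E}y\iff\sum_{n}d_n(x(n),y(n))^p<\infty$. For $z\in\prod_n Z_n$ let $\ell_p((Z_n)_n,z)=\{y\in\prod_n Z_n:\sum_n d_n(y(n),z(n))^p<\infty\}$ with the pseudo-metric $\left(\sum_n d_n(x(n),y(n))^p\right)^{1/p}$. For equivalence relations $E,F$ on $P,Q$, write $E\le_B F$ if there is a Borel map $\theta:P\to Q$ with $x\mathrel{E}y\iff\theta(x)\mathrel{F}\theta(y)$ for all $x,y\in P$. For a nonempty separable complete metric space $X$, $F(X;p)$ denotes $E((F_n)_n;p)$, where $F_0\subseteq F_1\subseteq\cdots$ are nonempty finite subsets of $X$ with dense union (the choice of such a sequence is arbitrary; up to Borel bireducibility the relation does not depend on it). For $C>0$, a metric space $(X,d)$ satisfies $\mathrm{link}(C)$ if for every $\varepsilon>0$ there is $N\ge1$ such that for all $u,v\in X$ with $d(u,v)<C$ there are $r_0,\dots,r_N\in X$ with $r_0=u$, $r_N=v$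 and $d(r_{i-1},r_i)<\varepsilon$ for $1\le i\le N$. For $C,\alpha>0$, $(X,d)$ can $C$-finitely Hölder$(\alpha)$ embed into a pseudo-metric space $(X',d')$ if there are $A,D>0$ such that for every finite $F\subseteq X$ there is $T_F:F\to X'$ such that for all $u,v\in F$: if $d(u,v)\ge C$ then $d'(T_F(u),T_F(v))\ge D$; and if $d(u,v)<C$ then $A^{-1}d(u,v)^\alpha\le d'(T_F(u),T_F(v))\le A\,d(u,v)^\alpha$. \textbf{Theorem.} Let $(X,d)$ and $(Y,\delta)$ be nonempty separable complete metric spaces, $p,q\in[1,\infty)$, and let $Y_0\subseteq Y_1\subseteq Y_2\subseteq\cdots$ be nonempty Borel subsets of $Y$ with $\bigcup_{n}Y_n$ dense in $Y$. Let $C>0$ and suppose that $X$ satisfies $\mathrm{link}(C)$. Then, for any choice of the sequences of finite sets defining $F(X;p)$ and $F(Y;q)$, the following conditions are equivalent: (a) $X$ can $C$-finitely Hölder$(p/q)$ embed into $\ell_q((Y_n)_{n},y^*)$ for some $y^*\in\prod_{n}Y_n$; (b) $F(X;p)\le_B E((Y_n)_{n};q)$; (c) $F(X;p)\le_B F(Y;q)$.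 -/

import Mathlib

theorem summable_dist_rpow_triangle {Z : ℕ → Type*} [∀ n, PseudoMetricSpace (Z n)] {p : ℝ}
    (hp : 1 ≤ p) {x y z : ∀ n, Z n} (hxy : Summable fun n => dist (x n) (y n) ^ p)
    (hyz : Summable fun n => dist (y n) (z n) ^ p) :
    (Summable fun n => dist (x n) (z n) ^ p) ∧
      (∑' n, dist (x n) (z n) ^ p) ^ (1 / p) ≤
        (∑' n, dist (x n) (y n) ^ p) ^ (1 / p) + (∑' n, dist (y n) (z n) ^ p) ^ (1 / p) := by
  have hp0 : 0 ≤ p := zero_le_one.trans hp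
  obtain ⟨hs, hle⟩ := Real.Lp_add_le_tsum_of_nonneg hp (f := fun n => dist (x n) (y n))
    (g := fun n => dist (y n) (z n)) (fun _ => dist_nonneg) (fun _ => dist_nonneg) hxy hyz
  have hterm : ∀ n, dist (x n) (z n) ^ p ≤ (dist (x n) (y n) + dist (y n) (z n)) ^ p := fun n =>
    Real.rpow_le_rpow dist_nonneg (dist_triangle _ _ _) hp0
  have hxz : Summable fun n => dist (x n) (z n) ^ p :=
    Summable.of_nonneg_of_le (fun n => Real.rpow_nonneg dist_nonneg p) hterm hs
  refine ⟨hxz, le_trans ?_ hle⟩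
  exact Real.rpow_le_rpow (tsum_nonneg fun n => Real.rpow_nonneg dist_nonneg p)
    (hxz.tsum_le_tsum hterm hs) (by positivity)

/-- The `ℓ_p`-like equivalence relation `E((Z_n); p)` on `∏ Z_n`:
`x` and `y` are equivalent iff `∑ d_n(x(n), y(n))^p < ∞`. -/
def ellRel (Z : ℕ → Type*) [∀ n, PseudoMetricSpace (Z n)] {p : ℝ} (hp : 1 ≤ p) :
    Setoid (∀ n, Z n) where
  r x y := Summable fun n => dist (x n) (y n) ^ p
  iseqv :=
    { refl := fun x => by
        have hp0 : p ≠ 0 := by linarith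
        simp [Real.zero_rpow hp0, summable_zero]
      symm := fun {x y} h => by simpa only [dist_comm] using h
      trans := fun h₁ h₂ => (summable_dist_rpow_triangle hp h₁ h₂).1 }

/-- The space `ℓ_q((Z_n), z)`: the sequences at finite `ℓ_q`-distance from the base point `z`. -/
def EllSpace (Z : ℕ → Type*) [∀ n, PseudoMetricSpace (Z n)] (z : ∀ n, Z n) {q : ℝ}
    (_hq : 1 ≤ q) : Type _ :=
  {y : ∀ n, Z n // Summable fun n => dist (y n) (z n) ^ q}

/-- The pseudo-metric `δ_q(x, y) = (∑ δ_n(x(n), y(n))^q)^(1/q)` on `ℓ_q((Z_n), z)`. -/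
noncomputable instance EllSpace.instPseudoMetricSpace (Z : ℕ → Type*)
    [∀ n, PseudoMetricSpace (Z n)] (z : ∀ n, Z n) {q : ℝ} (hq : 1 ≤ q) :
    PseudoMetricSpace (EllSpace Z z hq) where
  dist x y := (∑' n, dist (x.1 n) (y.1 n) ^ q) ^ (1 / q)
  dist_self x := by
    have hq0 : q ≠ 0 := by linarith
    simp [Real.zero_rpow hq0, hq0]
  dist_comm x y := by simp only [dist_comm]
  dist_triangle x y w := by
    have key : ∀ a b : EllSpace Z z hq, Summable fun n => dist (a.1 n) (b.1 n) ^ q := fun a b =>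
      (summable_dist_rpow_triangle hq a.2 (by simpa only [dist_comm] using b.2)).1
    exact (summable_dist_rpow_triangle hq (key x y) (key y w)).2

/-- `E ≤_B F`: there is a Borel map `θ` with `x E y ↔ θ(x) F θ(y)`. -/
def BorelReducible {α β : Type*} [MeasurableSpace α] [MeasurableSpace β]
    (E : Setoid α) (F : Setoid β) : Prop :=
  ∃ θ : α → β, Measurable θ ∧ ∀ x y, E x y ↔ F (θ x) (θ y)

/-- An increasing sequence of nonempty finite subsets of `X` with dense union. For such a sequence
`F(X; p)` denotes the relation `E((F_n); p)`. -/
structure IsFiniteExhaustion {X : Type*} [TopologicalSpace X] (F : ℕ → Set X) : Prop where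
  finite : ∀ n, (F n).Finite
  nonempty : ∀ n, (F n).Nonempty
  mono : Monotone F
  dense : Dense (⋃ n, F n)

/-- The condition `link(C)`. -/
def Link (X : Type*) [PseudoMetricSpace X] (C : ℝ) : Prop :=
  ∀ ε : ℝ, 0 < ε → ∃ N : ℕ, 1 ≤ N ∧ ∀ u v : X, dist u v < C →
    ∃ r : ℕ → X, r 0 = u ∧ r N = v ∧ ∀ i < N, dist (r i) (r (i + 1)) < ε

/-- `X` can `C`-finitely Hölder(`α`) embed into `X'`. -/
def FinitelyHolderEmbeds (X X' : Type*) [PseudoMetricSpace X] [PseudoMetricSpace X']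
    (C α : ℝ) : Prop :=
  ∃ A D : ℝ, 0 < A ∧ 0 < D ∧ ∀ F : Finset X, ∃ T : F → X', ∀ u v : F,
    (C ≤ dist u v → D ≤ dist (T u) (T v)) ∧
    (dist u v < C →
      A⁻¹ * dist u v ^ α ≤ dist (T u) (T v) ∧ dist (T u) (T v) ≤ A * dist u v ^ α)

/-! ### Distances in the spaces `EllSpace`. -/

open Filter Topology

/-! The substance of the theorem is that a Borel reduction into an ℓ_q-like relation can be made to
act coordinate by coordinate.

From embeddings to reductions: apply a Hölder embedding of the finite set F_n to the n-th coordinate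
and lay the images out as a double sequence. The exponent p/q makes p-th powers of distances
comparable with q-th powers of image distances (`borelReducible_of_finitelyHolderEmbeds`).

Conversely, a Baire category argument near a generic point yields a subproduct on which the
reduction is, up to a summable error, a concatenation of blocks, each depending on one coordinate
(`exists_blocks`). The block maps S_j preserve and reflect summability. If they broke the Hölder
bounds by unbounded factors, repeating the bad pairs suitably often would give a sum finite on one
side only (`exists_dist_rpow_le`, `exists_le_dist_rpow`); the link condition supplies the a priori
bound needed for the upper estimate. A single S_j with j large then embeds a given finite set.

Finally, finitely many points of an ℓ_q space are determined, up to a small error, by finitely many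
coordinates, so an embedding passes to any increasing sequence of subsets with dense union
(`FinitelyHolderEmbeds.transfer`). This links (a) with (c). -/

theorem EllSpace.dist_def {Z : ℕ → Type*} [∀ n, PseudoMetricSpace (Z n)] {z : ∀ n, Z n} {q : ℝ}
    {hq : 1 ≤ q} (x y : EllSpace Z z hq) :
    dist x y = (∑' n, dist (x.1 n) (y.1 n) ^ q) ^ (1 / q) := rfl

theorem EllSpace.summable_dist_rpow {Z : ℕ → Type*} [∀ n, PseudoMetricSpace (Z n)]
    {z : ∀ n, Z n} {q : ℝ} {hq : 1 ≤ q} (x y : EllSpace Z z hq) :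
    Summable fun n => dist (x.1 n) (y.1 n) ^ q :=
  (summable_dist_rpow_triangle hq x.2 (by simpa only [dist_comm] using y.2)).1

theorem EllSpace.dist_rpow {Z : ℕ → Type*} [∀ n, PseudoMetricSpace (Z n)]
    {z : ∀ n, Z n} {q : ℝ} {hq : 1 ≤ q} (x y : EllSpace Z z hq) :
    dist x y ^ q = ∑' n, dist (x.1 n) (y.1 n) ^ q := by
  rw [EllSpace.dist_def, one_div, Real.rpow_inv_rpow _ (by linarith)]
  exact tsum_nonneg fun n => by positivity

/-- The point of `ℓ_q((Z_n), z)` that agrees with `w` on the finite set `s` and with the base point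
elsewhere. -/
noncomputable def EllSpace.modify {Z : ℕ → Type*} [∀ n, PseudoMetricSpace (Z n)]
    (z : ∀ n, Z n) {q : ℝ} (hq : 1 ≤ q) (s : Finset ℕ) (w : ∀ n, Z n) : EllSpace Z z hq :=
  ⟨fun n => if n ∈ s then w n else z n, by
    refine summable_of_ne_finset_zero (s := s) fun n hn => ?_
    simp [hn, Real.zero_rpow (by linarith : q ≠ 0)]⟩

theorem EllSpace.dist_modify_rpow {Z : ℕ → Type*} [∀ n, PseudoMetricSpace (Z n)]
    (z : ∀ n, Z n) {q : ℝ} (hq : 1 ≤ q) (s : Finset ℕ) (w w' : ∀ n, Z n) :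
    dist (EllSpace.modify z hq s w) (EllSpace.modify z hq s w') ^ q =
      ∑ n ∈ s, dist (w n) (w' n) ^ q := by
  rw [EllSpace.dist_rpow, tsum_eq_sum (s := s)]
  · refine Finset.sum_congr rfl fun n hn => ?_
    simp [EllSpace.modify, hn]
  · intro n hn
    simp [EllSpace.modify, hn, Real.zero_rpow (by linarith : q ≠ 0)]

theorem EllSpace.dist_modify {Z : ℕ → Type*} [∀ n, PseudoMetricSpace (Z n)]
    (z : ∀ n, Z n) {q : ℝ} (hq : 1 ≤ q) (s : Finset ℕ) (w w' : ∀ n, Z n) :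
    dist (EllSpace.modify z hq s w) (EllSpace.modify z hq s w') =
      (∑ n ∈ s, dist (w n) (w' n) ^ q) ^ (1 / q) := by
  rw [← EllSpace.dist_modify_rpow z hq, one_div, Real.rpow_rpow_inv dist_nonneg (by linarith)]

/-! ### From Hölder embeddings to Borel reductions. -/

/-- Maps that are uniformly Hölder(`p / q`) below scale `C`, and uniformly separating above it,
turn `ℓ_p`-closeness into `ℓ_q`-closeness and conversely. -/
theorem summable_rpow_iff_of_holder {p q C A D : ℝ} (hp : 1 ≤ p) (hq : 1 ≤ q) (hC : 0 < C)
    (hA : 0 < A) (hD : 0 < D) {d e : ℕ → ℝ} (hd : ∀ n, 0 ≤ d n) (he : ∀ n, 0 ≤ e n)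
    (h₁ : ∀ n, C ≤ d n → D ≤ e n)
    (h₂ : ∀ n, d n < C → A⁻¹ * d n ^ (p / q) ≤ e n ∧ e n ≤ A * d n ^ (p / q)) :
    (Summable fun n => d n ^ p) ↔ Summable fun n => e n ^ q := by
  have hp0 : 0 < p := by linarith
  have hq0 : 0 < q := by linarith
  -- Terms of a convergent sum are eventually below `C` or `D`, so the Hölder bounds are only needed
  -- from some index on.
  have tend : ∀ {f : ℕ → ℝ} {r : ℝ}, 0 < r → (∀ n, 0 ≤ f n) → (Summable fun n => f n ^ r) →
      ∀ ε > 0, ∀ᶠ n in atTop, f n < ε := by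
    intro f r hr hf hs ε hε
    have := hs.tendsto_atTop_zero.eventually (gt_mem_nhds (Real.rpow_pos_of_pos hε r))
    filter_upwards [this] with n hn
    exact (Real.rpow_lt_rpow_iff (hf n) hε.le hr).1 hn
  have pw : ∀ n, (d n ^ (p / q)) ^ q = d n ^ p := fun n => by
    rw [← Real.rpow_mul (hd n), div_mul_cancel₀ _ hq0.ne']
  constructor
  · intro hs
    refine Summable.of_norm_bounded_eventually_nat (hs.mul_left (A ^ q)) ?_
    filter_upwards [tend hp0 hd hs C hC] with n hn
    rw [Real.norm_of_nonneg (Real.rpow_nonneg (he n) q), ← pw,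
      ← Real.mul_rpow hA.le (Real.rpow_nonneg (hd n) _)]
    exact Real.rpow_le_rpow (he n) (h₂ n hn).2 hq0.le
  · intro hs
    refine Summable.of_norm_bounded_eventually_nat (hs.mul_left (A ^ q)) ?_
    filter_upwards [tend hq0 he hs D hD] with n hn
    have hn' : d n < C := by
      by_contra! h
      exact (h₁ n h).not_gt hn
    rw [Real.norm_of_nonneg (Real.rpow_nonneg (hd n) p), ← pw, ← Real.mul_rpow hA.le (he n)]
    refine Real.rpow_le_rpow (Real.rpow_nonneg (hd n) _) ?_ hq0.le
    exact (inv_mul_le_iff₀ hA).1 (h₂ n hn').1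

theorem borelReducible_of_finitelyHolderEmbeds {X Y : Type*} [MetricSpace X] [MeasurableSpace X]
    [BorelSpace X] [MetricSpace Y] [MeasurableSpace Y] {p q C : ℝ} (hp : 1 ≤ p) (hq : 1 ≤ q)
    (hC : 0 < C) {F : ℕ → Set X} (hF : ∀ n, (F n).Finite) {Z : ℕ → Set Y} (hZ : Monotone Z)
    {z : ∀ n, Z n} (h : FinitelyHolderEmbeds X (EllSpace (fun n => Z n) z hq) C (p / q)) :
    BorelReducible (ellRel (fun n => F n) hp) (ellRel (fun n => Z n) hq) := by
  obtain ⟨A, D, hA, hD, h⟩ := h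
  choose T hT using fun n => h (hF n).toFinset
  let S : ∀ n, F n → EllSpace (fun n => Z n) z hq := fun n u =>
    T n ⟨u.1, (hF n).mem_toFinset.2 u.2⟩
  have hS : ∀ n (u v : F n), (C ≤ dist u v → D ≤ dist (S n u) (S n v)) ∧ (dist u v < C →
      A⁻¹ * dist u v ^ (p / q) ≤ dist (S n u) (S n v) ∧
        dist (S n u) (S n v) ≤ A * dist u v ^ (p / q)) := fun n u v => hT n ⟨u.1, _⟩ ⟨v.1, _⟩
  -- The pairing function enumerates the double sequence; since its second component is at most `k`,
  -- monotonicity of `Z` puts the entry in `Z k`.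
  let θ : (∀ n, F n) → ∀ n, Z n := fun x k =>
    ⟨((S k.unpair.1 (x k.unpair.1)).1 k.unpair.2).1, hZ (Nat.unpair_right_le k) (Subtype.prop _)⟩
  refine ⟨θ, ?_, fun x y => ?_⟩
  · refine measurable_pi_lambda _ fun k => ?_
    have : ∀ n, Finite (F n) := fun n => hF n
    exact (measurable_of_finite (fun u : F k.unpair.1 =>
      (⟨((S k.unpair.1 u).1 k.unpair.2).1, hZ (Nat.unpair_right_le k) (Subtype.prop _)⟩ :
        Z k))).comp (measurable_pi_apply _)
  · change (Summable fun n => dist (x n) (y n) ^ p) ↔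
      Summable fun k => dist (θ x k) (θ y k) ^ q
    rw [summable_rpow_iff_of_holder (d := fun n => dist (x n) (y n))
      (e := fun n => dist (S n (x n)) (S n (y n))) hp hq hC hA hD
      (fun _ => dist_nonneg) (fun _ => dist_nonneg)
      (fun n => (hS n _ _).1) (fun n => (hS n _ _).2)]
    simp only [EllSpace.dist_rpow]
    have hθ : (fun k => dist (θ x k) (θ y k) ^ q) = (fun a : ℕ × ℕ =>
        dist ((S a.1 (x a.1)).1 a.2) ((S a.1 (y a.1)).1 a.2) ^ q) ∘ Nat.pairEquiv.symm := by
      funext k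
      rw [Function.comp_apply, Nat.pairEquiv_symm_apply, Subtype.dist_eq, Subtype.dist_eq]
    rw [hθ, Equiv.summable_iff, summable_prod_of_nonneg fun a => by positivity]
    exact (and_iff_right fun n => (S n (x n)).summable_dist_rpow (S n (y n))).symm

/-! ### Passing between ℓ_q spaces over different subsets of Y. -/

/-- Finite sets of points of `ℓ_q((Y_n), y)` can be copied into `ℓ_q((Z_n), z)` up to an arbitrarily
small error in the mutual distances. -/
theorem EllSpace.exists_approx {Y : Type*} [MetricSpace Y] {q : ℝ} (hq : 1 ≤ q)
    {W : ℕ → Set Y} {w : ∀ n, W n} {Z : ℕ → Set Y} (hZ : Monotone Z)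
    (hZd : Dense (⋃ n, Z n)) (z : ∀ n, Z n) {ι : Type*} [Finite ι]
    (T : ι → EllSpace (fun n => W n) w hq) {η : ℝ} (hη : 0 < η) :
    ∃ T' : ι → EllSpace (fun n => Z n) z hq, ∀ u v,
      |dist (T' u) (T' v) - dist (T u) (T v)| < η := by
  have hq0 : 0 < q := by linarith
  have h₁ : ∀ᶠ m in atTop, ∀ u v,
      |(∑ i ∈ Finset.range m, dist ((T u).1 i) ((T v).1 i) ^ q) ^ (1 / q) - dist (T u) (T v)|
        < η / 2 := by
    refine eventually_all.2 fun u => eventually_all.2 fun v => ?_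
    have := (EllSpace.summable_dist_rpow (T u) (T v)).hasSum.tendsto_sum_nat.rpow_const
      (p := 1 / q) (Or.inr (by positivity))
    exact (Metric.tendsto_nhds.1 this) _ (half_pos hη)
  obtain ⟨m, hm⟩ := h₁.exists
  have hs : ∀ (u : ι) (i : ℕ), ∃ s : ℕ → Y, (∀ t, s t ∈ ⋃ n, Z n) ∧
      Tendsto s atTop (𝓝 ((T u).1 i).1) := fun u i => mem_closure_iff_seq_limit.1 (hZd _)
  choose s hsZ hs using hs
  have h₂ : ∀ᶠ t in atTop, ∀ u v,
      |(∑ i ∈ Finset.range m, dist (s u i t) (s v i t) ^ q) ^ (1 / q) -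
        (∑ i ∈ Finset.range m, dist ((T u).1 i) ((T v).1 i) ^ q) ^ (1 / q)| < η / 2 := by
    refine eventually_all.2 fun u => eventually_all.2 fun v => ?_
    have : Tendsto (fun t => (∑ i ∈ Finset.range m, dist (s u i t) (s v i t) ^ q) ^ (1 / q)) atTop
        (𝓝 ((∑ i ∈ Finset.range m, dist ((T u).1 i) ((T v).1 i) ^ q) ^ (1 / q))) := by
      refine Tendsto.rpow_const (tendsto_finsetSum _ fun i _ => ?_) (Or.inr (by positivity))
      exact ((hs u i).dist (hs v i)).rpow_const (Or.inr hq0.le)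
    exact (Metric.tendsto_nhds.1 this) _ (half_pos hη)
  obtain ⟨t, ht⟩ := h₂.exists
  have hK : ∀ᶠ K in atTop, ∀ u, ∀ i : Fin m, s u i t ∈ Z K := by
    refine eventually_all.2 fun u => eventually_all.2 fun i => ?_
    obtain ⟨K, hK⟩ := Set.mem_iUnion.1 (hsZ u i t)
    exact eventually_atTop.2 ⟨K, fun L hL => hZ hL hK⟩
  obtain ⟨K, hK⟩ := hK.exists
  classical
  -- Shifting the `m` relevant coordinates to start at `K` ensures that all the approximating points
  -- lie in the available sets.
  let g : ι → ∀ n, Z n := fun u n =>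
    if h : s u (n - K) t ∈ Z n then ⟨_, h⟩ else z n
  have hg : ∀ u, ∀ i < m, (g u (K + i)).1 = s u i t := fun u i hi => by
    have : s u (K + i - K) t ∈ Z (K + i) := by
      rw [Nat.add_sub_cancel_left]
      exact hZ (Nat.le_add_right K i) (hK u ⟨i, hi⟩)
    simp only [g, dif_pos this, Nat.add_sub_cancel_left]
  refine ⟨fun u => EllSpace.modify z hq (Finset.Ico K (K + m)) (g u), fun u v => ?_⟩
  have hsum : ∑ n ∈ Finset.Ico K (K + m), dist (g u n) (g v n) ^ q =
      ∑ i ∈ Finset.range m, dist (s u i t) (s v i t) ^ q := by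
    rw [Finset.sum_Ico_eq_sum_range, Nat.add_sub_cancel_left]
    refine Finset.sum_congr rfl fun i hi => ?_
    rw [Subtype.dist_eq, hg u i (Finset.mem_range.1 hi), hg v i (Finset.mem_range.1 hi)]
  rw [EllSpace.dist_modify, hsum]
  have a := ht u v
  have b := hm u v
  rw [abs_lt] at *
  constructor <;> linarith [a.1, a.2, b.1, b.2]

/-- On a finite set the images of distinct points have positive distance, so an error below half of
the least such distance costs only a factor 2 in the constants. -/
theorem FinitelyHolderEmbeds.transfer {X Y : Type*} [MetricSpace X] [MetricSpace Y] {q C α : ℝ}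
    (hq : 1 ≤ q) (hα : 0 < α) {W : ℕ → Set Y} {w : ∀ n, W n} {Z : ℕ → Set Y}
    (hZ : Monotone Z) (hZd : Dense (⋃ n, Z n)) (z : ∀ n, Z n)
    (h : FinitelyHolderEmbeds X (EllSpace (fun n => W n) w hq) C α) :
    FinitelyHolderEmbeds X (EllSpace (fun n => Z n) z hq) C α := by
  obtain ⟨A, D, hA, hD, h⟩ := h
  refine ⟨2 * A, D / 2, by positivity, by positivity, fun F => ?_⟩
  obtain ⟨T, hT⟩ := h F
  have hη : ∀ᶠ η in 𝓝[>] (0 : ℝ), 0 < η ∧ ∀ u v : F, 0 < dist (T u) (T v) →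
      η < dist (T u) (T v) / 2 := by
    refine Filter.Eventually.and self_mem_nhdsWithin ?_
    refine eventually_all.2 fun u => eventually_all.2 fun v => ?_
    by_cases huv : 0 < dist (T u) (T v)
    · filter_upwards [nhdsWithin_le_nhds (gt_mem_nhds (half_pos huv))] with η hη _ using hη
    · simp [huv]
  obtain ⟨η, hη0, hη⟩ := hη.exists
  obtain ⟨T', hT'⟩ := EllSpace.exists_approx hq hZ hZd z T hη0
  refine ⟨T', fun u v => ⟨fun huv => ?_, fun huv => ?_⟩⟩
  · have h₁ := (hT u v).1 huv
    have h₂ := hη u v (hD.trans_le h₁)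
    have h₃ := abs_lt.1 (hT' u v)
    linarith [h₃.1]
  · obtain ⟨h₁, h₂⟩ := (hT u v).2 huv
    rcases eq_or_ne u v with rfl | hne
    · simp [Real.zero_rpow hα.ne']
    · have hpos : 0 < A⁻¹ * dist u v ^ α := by
        have := dist_pos.2 hne
        positivity
      have h₃ := hη u v (hpos.trans_le h₁)
      have h₄ := abs_lt.1 (hT' u v)
      have h₅ : (2 * A)⁻¹ * dist u v ^ α = A⁻¹ * dist u v ^ α / 2 := by
        rw [mul_inv]; ring
      rw [h₅]
      constructor <;> linarith [h₄.1, h₄.2]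

/-! ### Hölder estimates for coordinatewise reductions. -/

theorem exists_injective_of_frequently {ι : Type*} [Countable ι] {P : ι → ℕ → Prop}
    (h : ∀ i, ∃ᶠ j in atTop, P i j) : ∃ φ : ι → ℕ, Function.Injective φ ∧ ∀ i, P i (φ i) := by
  have := Encodable.ofCountable ι
  have h' : ∀ n, ∃ᶠ j in atTop, ∀ i : ι, Encodable.encode i = n → P i j := fun n => by
    by_cases hn : ∃ i : ι, Encodable.encode i = n
    · obtain ⟨i, rfl⟩ := hn
      refine (h i).mono fun j hj i' hi' => ?_
      rwa [Encodable.encode_injective hi']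
    · exact Frequently.of_forall fun j i hi => (hn ⟨i, hi⟩).elim
  obtain ⟨φ, hφ, hP⟩ := Filter.extraction_forall_of_frequently h'
  exact ⟨fun i => φ (Encodable.encode i), hφ.injective.comp Encodable.encode_injective,
    fun i => hP _ i rfl⟩

theorem IsFiniteExhaustion.eventually_mem {X : Type*} [TopologicalSpace X] {F : ℕ → Set X}
    (hF : IsFiniteExhaustion F) {u : X} (hu : u ∈ ⋃ n, F n) : ∀ᶠ j in atTop, u ∈ F j := by
  obtain ⟨n, hn⟩ := Set.mem_iUnion.1 hu
  exact eventually_atTop.2 ⟨n, fun m hm => hF.mono hm hn⟩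

theorem IsFiniteExhaustion.comp {X : Type*} [TopologicalSpace X] {F : ℕ → Set X}
    (hF : IsFiniteExhaustion F) {n : ℕ → ℕ} (hn : StrictMono n) :
    IsFiniteExhaustion fun j => F (n j) where
  finite _ := hF.finite _
  nonempty _ := hF.nonempty _
  mono _ _ h := hF.mono (hn.monotone h)
  dense := hF.dense.mono (Set.iUnion_mono fun _ => hF.mono hn.le_apply)

/-- The maps `S_j`, restricted to `F_j`, jointly reduce `E((F_j); p)` to an `ℓ_q`-sum. -/
def ReducesSum {X E : Type*} [MetricSpace X] [PseudoMetricSpace E] (F : ℕ → Set X)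
    (S : ℕ → X → E) (p q : ℝ) : Prop :=
  ∀ x y : ℕ → X, (∀ j, x j ∈ F j) → (∀ j, y j ∈ F j) →
    ((Summable fun j => dist (x j) (y j) ^ p) ↔ Summable fun j => dist (S j (x j)) (S j (y j)) ^ q)

namespace ReducesSum

variable {X E : Type*} [MetricSpace X] [PseudoMetricSpace E] {F : ℕ → Set X} {S : ℕ → X → E}
  {p q C : ℝ}

/-- Pairs placed at distinct coordinates can be tested for summability: a common filler at the
remaining coordinates contributes zero to both sums. -/
theorem of_injective (hp : 1 ≤ p) (hq : 1 ≤ q) (hF : IsFiniteExhaustion F)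
    (h : ReducesSum F S p q) {ι : Type*} {φ : ι → ℕ} (hφ : Function.Injective φ) {u v : ι → X}
    (hu : ∀ i, u i ∈ F (φ i)) (hv : ∀ i, v i ∈ F (φ i)) :
    (Summable fun i => dist (u i) (v i) ^ p) ↔
      Summable fun i => dist (S (φ i) (u i)) (S (φ i) (v i)) ^ q := by
  have hp0 : p ≠ 0 := by linarith
  have hq0 : q ≠ 0 := by linarith
  choose b hb using hF.nonempty
  have hxF : ∀ w : ι → X, (∀ i, w i ∈ F (φ i)) → ∀ j, Function.extend φ w b j ∈ F j := by
    intro w hw j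
    by_cases hj : ∃ i, φ i = j
    · obtain ⟨i, rfl⟩ := hj
      rw [hφ.extend_apply]
      exact hw i
    · rw [Function.extend_apply' _ _ _ hj]
      exact hb j
  have key := h _ _ (hxF u hu) (hxF v hv)
  have hout : ∀ w : ι → X, ∀ j ∉ Set.range φ, Function.extend φ w b j = b j := fun w j hj =>
    Function.extend_apply' _ _ _ hj
  rw [← hφ.summable_iff, ← hφ.summable_iff] at key
  · simpa [Function.comp_def, hφ.extend_apply] using key
  · intro j hj
    simp [hout _ j hj, hq0]
  · intro j hj
    simp [hout _ j hj, hp0]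

/-- Otherwise pairs at distance at least `c` with images closer than `2^{-k}` could be placed at
distinct coordinates, and only the image sum would converge. -/
theorem exists_le_dist (hp : 1 ≤ p) (hq : 1 ≤ q) (hF : IsFiniteExhaustion F)
    (h : ReducesSum F S p q) {c : ℝ} (hc : 0 < c) :
    ∃ D > 0, ∀ᶠ j in atTop, ∀ u ∈ F j, ∀ v ∈ F j, c ≤ dist u v → D ≤ dist (S j u) (S j v) := by
  have hp0 : 0 < p := by linarith
  by_contra! hcon
  have h' : ∀ k : ℕ, ∃ᶠ j in atTop, ∃ u ∈ F j, ∃ v ∈ F j, c ≤ dist u v ∧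
      dist (S j u) (S j v) < (1 / 2) ^ k := fun k => by
    refine (hcon ((1 / 2) ^ k) (by positivity)).mono fun j hj => ?_
    simpa using hj
  obtain ⟨φ, hφ, hP⟩ := exists_injective_of_frequently h'
  choose u hu v hv hd hs using hP
  have hsum := (h.of_injective hp hq hF hφ hu hv).2 <| by
    refine Summable.of_nonneg_of_le (fun k => by positivity) (fun k => ?_)
      (summable_geometric_two)
    have h1 : dist (S (φ k) (u k)) (S (φ k) (v k)) ≤ 1 :=
      (hs k).le.trans (pow_le_one₀ (by norm_num) (by norm_num))
    calc dist (S (φ k) (u k)) (S (φ k) (v k)) ^ q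
        ≤ dist (S (φ k) (u k)) (S (φ k) (v k)) ^ (1 : ℝ) :=
          Real.rpow_le_rpow_of_exponent_ge' dist_nonneg h1 zero_le_one hq
      _ ≤ _ := by rw [Real.rpow_one]; exact (hs k).le
  have hlim := hsum.tendsto_atTop_zero.eventually (gt_mem_nhds (Real.rpow_pos_of_pos hc p))
  obtain ⟨k, hk⟩ := hlim.exists
  exact hk.not_ge (Real.rpow_le_rpow hc.le (hd k) hp0.le)

theorem exists_dist_le_one (hp : 1 ≤ p) (hq : 1 ≤ q) (hF : IsFiniteExhaustion F)
    (h : ReducesSum F S p q) :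
    ∃ ε > 0, ∀ᶠ j in atTop, ∀ u ∈ F j, ∀ v ∈ F j, dist u v < ε → dist (S j u) (S j v) ≤ 1 := by
  have hq0 : 0 < q := by linarith
  by_contra! hcon
  have h' : ∀ k : ℕ, ∃ᶠ j in atTop, ∃ u ∈ F j, ∃ v ∈ F j, dist u v < (1 / 2) ^ k ∧
      1 < dist (S j u) (S j v) := fun k => by
    refine (hcon ((1 / 2) ^ k) (by positivity)).mono fun j hj => ?_
    simpa using hj
  obtain ⟨φ, hφ, hP⟩ := exists_injective_of_frequently h'
  choose u hu v hv hd hs using hP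
  have hsum := (h.of_injective hp hq hF hφ hu hv).1 <| by
    refine Summable.of_nonneg_of_le (fun k => by positivity) (fun k => ?_)
      (summable_geometric_two)
    have h1 : dist (u k) (v k) ≤ 1 :=
      (hd k).le.trans (pow_le_one₀ (by norm_num) (by norm_num))
    calc dist (u k) (v k) ^ p
        ≤ dist (u k) (v k) ^ (1 : ℝ) :=
          Real.rpow_le_rpow_of_exponent_ge' dist_nonneg h1 zero_le_one hp
      _ ≤ _ := by rw [Real.rpow_one]; exact (hd k).le
  obtain ⟨k, hk⟩ := (hsum.tendsto_atTop_zero.eventually (gt_mem_nhds one_pos)).exists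
  exact hk.not_ge (Real.one_le_rpow (hs k).le hq0.le)

/-- Each short link is mapped to length at most 1. The bound `N` is uniform, but the threshold for
`j` depends on the pair, since the whole chain has to lie in `F j`. -/
theorem exists_dist_le_of_link (hp : 1 ≤ p) (hq : 1 ≤ q) (hF : IsFiniteExhaustion F)
    (h : ReducesSum F S p q) (hlink : Link X C) :
    ∃ N : ℕ, ∀ u ∈ ⋃ n, F n, ∀ v ∈ ⋃ n, F n, dist u v < C →
      ∀ᶠ j in atTop, dist (S j u) (S j v) ≤ N := by
  obtain ⟨ε, hε, hS⟩ := h.exists_dist_le_one hp hq hF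
  -- A third of `ε` for the link and one for moving each of its ends into the dense union.
  obtain ⟨N, hN1, hN⟩ := hlink (ε / 3) (by positivity)
  refine ⟨N, fun u hu v hv huv => ?_⟩
  obtain ⟨r, hr0, hrN, hr⟩ := hN u v huv
  have happ : ∀ i, ∃ r' ∈ ⋃ n, F n, dist (r i) r' < ε / 3 := fun i =>
    hF.dense.exists_dist_lt (r i) (by positivity)
  choose a ha had using happ
  let r' : ℕ → X := fun i => if i = 0 then u else if i = N then v else a i
  have hr'F : ∀ i, r' i ∈ ⋃ n, F n := fun i => by
    by_cases h0 : i = 0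
    · simpa only [r', if_pos h0] using hu
    · by_cases h1 : i = N
      · simpa only [r', if_neg h0, if_pos h1] using hv
      · simpa only [r', if_neg h0, if_neg h1] using ha i
  have hr'd : ∀ i, dist (r i) (r' i) < ε / 3 := fun i => by
    by_cases h0 : i = 0
    · subst h0
      simpa [r', hr0] using hε
    · by_cases h1 : i = N
      · subst h1
        simpa [r', hrN, h0] using hε
      · simpa only [r', if_neg h0, if_neg h1] using had i
  have hr'0 : r' 0 = u := by simp [r']
  have hr'N : r' N = v := by simp [r', Nat.one_le_iff_ne_zero.1 hN1]
  have hmem : ∀ᶠ j in atTop, ∀ i ∈ Finset.range (N + 1), r' i ∈ F j :=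
    (eventually_all_finset _).2 fun i _ => hF.eventually_mem (hr'F i)
  filter_upwards [hS, hmem] with j hSj hj
  calc dist (S j u) (S j v) = dist (S j (r' 0)) (S j (r' N)) := by rw [hr'0, hr'N]
    _ ≤ ∑ i ∈ Finset.range N, dist (S j (r' i)) (S j (r' (i + 1))) :=
        dist_le_range_sum_dist (fun i => S j (r' i)) N
    _ ≤ ∑ i ∈ Finset.range N, 1 := by
        refine Finset.sum_le_sum fun i hi => ?_
        have hi' := Finset.mem_range.1 hi
        refine hSj _ (hj i (Finset.mem_range.2 (by omega))) _
          (hj (i + 1) (Finset.mem_range.2 (by omega))) ?_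
        have h1 := dist_triangle4 (r' i) (r i) (r (i + 1)) (r' (i + 1))
        have h2 := hr'd i
        rw [dist_comm] at h2
        linarith [hr i hi', hr'd (i + 1)]
    _ = N := by simp

/-- If `ρ_j(u_k, v_k)` satisfies `P k` for infinitely many `j`, then each pair `(u_k, v_k)` can be
placed at `M k` coordinates `j` with that property. -/
theorem exists_repeat (hp : 1 ≤ p) (hq : 1 ≤ q) (hF : IsFiniteExhaustion F)
    (h : ReducesSum F S p q) {u v : ℕ → X} (hu : ∀ k, u k ∈ ⋃ n, F n)
    (hv : ∀ k, v k ∈ ⋃ n, F n) {P : ℕ → ℝ → Prop}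
    (hP : ∀ k, ∃ᶠ j in atTop, P k (dist (S j (u k)) (S j (v k)) ^ q)) (M : ℕ → ℕ) :
    ∃ ρ : (Σ k, Fin (M k)) → ℝ, (∀ i, 0 ≤ ρ i) ∧ (∀ i, P i.1 (ρ i)) ∧
      ((Summable fun k => M k * dist (u k) (v k) ^ p) ↔ Summable ρ) := by
  have h' : ∀ i : Σ k, Fin (M k), ∃ᶠ j in atTop,
      P i.1 (dist (S j (u i.1)) (S j (v i.1)) ^ q) ∧ u i.1 ∈ F j ∧ v i.1 ∈ F j := fun i =>
    (hP i.1).and_eventually ((hF.eventually_mem (hu i.1)).and (hF.eventually_mem (hv i.1)))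
  obtain ⟨φ, hφ, hφP⟩ := exists_injective_of_frequently h'
  refine ⟨fun i => dist (S (φ i) (u i.1)) (S (φ i) (v i.1)) ^ q, fun i => by positivity,
    fun i => (hφP i).1, ?_⟩
  rw [← h.of_injective hp hq hF hφ (fun i => (hφP i).2.1) (fun i => (hφP i).2.2),
    summable_sigma_of_nonneg fun i => by positivity]
  simp [tsum_fintype, Summable.of_finite]

theorem summable_of_repeat {M : ℕ → ℕ} {f : ℕ → ℝ} (hf : ∀ k, 0 ≤ f k) :
    (Summable fun i : Σ k, Fin (M k) => f i.1) ↔ Summable fun k => M k * f k := by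
  rw [summable_sigma_of_nonneg fun i => hf i.1]
  simp [tsum_fintype, Summable.of_finite]

/-- Let the ratio of image power to distance power exceed `2^k` for the k-th pair. The bound from
the link condition forces the distance power to be at most `2^{-k} N^q`, so the pair can be repeated
about `(2^k d^p)⁻¹` times with a summable total, while the image powers of each group add up to at
least 1. -/
theorem exists_dist_rpow_le (hp : 1 ≤ p) (hq : 1 ≤ q) (hF : IsFiniteExhaustion F)
    (h : ReducesSum F S p q) (hlink : Link X C) :
    ∃ A > 0, ∀ u ∈ ⋃ n, F n, ∀ v ∈ ⋃ n, F n, dist u v < C →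
      ∀ᶠ j in atTop, dist (S j u) (S j v) ^ q ≤ A * dist u v ^ p := by
  have hq0 : 0 < q := by linarith
  have hp0 : 0 < p := by linarith
  obtain ⟨N, hN⟩ := h.exists_dist_le_of_link hp hq hF hlink
  by_contra! hcon
  choose u hu v hv hd hf using fun k : ℕ => hcon (2 ^ k) (by positivity)
  have hpos : ∀ k, 0 < dist (u k) (v k) ^ p := fun k => by
    obtain ⟨j, hj⟩ := (hf k).exists
    rcases eq_or_ne (u k) (v k) with he | he
    · simp [he, hq0.ne', hp0.ne'] at hj
    · exact Real.rpow_pos_of_pos (dist_pos.2 he) p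
  have hsmall : ∀ k, dist (u k) (v k) ^ p ≤ (1 / 2) ^ k * (N : ℝ) ^ q := fun k => by
    obtain ⟨j, hj, hj'⟩ := ((hf k).and_eventually (hN _ (hu k) _ (hv k) (hd k))).exists
    have := hj.le.trans (Real.rpow_le_rpow dist_nonneg hj' hq0.le)
    rw [one_div, inv_pow]
    exact (le_inv_mul_iff₀ (by positivity)).2 this
  obtain ⟨ρ, hρ0, hρ, hiff⟩ := h.exists_repeat hp hq hF hu hv
    (P := fun k t => 2 ^ k * dist (u k) (v k) ^ p < t) hf
    (fun k => ⌈(2 ^ k * dist (u k) (v k) ^ p)⁻¹⌉₊)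
  have h₁ := hiff.1 <| by
    refine Summable.of_nonneg_of_le (fun k => by positivity) (fun k => ?_)
      ((summable_geometric_two).mul_right (1 + (N : ℝ) ^ q))
    have hle := (Nat.ceil_lt_add_one
      (inv_nonneg.2 (mul_nonneg (pow_nonneg zero_le_two k) (hpos k).le))).le
    calc (⌈(2 ^ k * dist (u k) (v k) ^ p)⁻¹⌉₊ : ℝ) * dist (u k) (v k) ^ p
        ≤ ((2 ^ k * dist (u k) (v k) ^ p)⁻¹ + 1) * dist (u k) (v k) ^ p :=
          mul_le_mul_of_nonneg_right hle (hpos k).le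
      _ = (1 / 2) ^ k + dist (u k) (v k) ^ p := by
          have := (hpos k).ne'
          rw [one_div, inv_pow, mul_inv, add_mul, one_mul, mul_assoc, inv_mul_cancel₀ this, mul_one]
      _ ≤ (1 / 2) ^ k * (1 + (N : ℝ) ^ q) := by linarith [hsmall k]
  have h₂ := (summable_of_repeat (f := fun k => 2 ^ k * dist (u k) (v k) ^ p)
    (fun k => by positivity)).1 (h₁.of_nonneg_of_le (fun i => by positivity) fun i => (hρ i).le)
  obtain ⟨k, hk⟩ := (h₂.tendsto_atTop_zero.eventually (gt_mem_nhds one_pos)).exists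
  refine hk.not_ge ?_
  have hk0 : 0 < 2 ^ k * dist (u k) (v k) ^ p := mul_pos (by positivity) (hpos k)
  exact (inv_le_iff_one_le_mul₀ hk0).1 (Nat.le_ceil _)

/-- Here each bad pair is repeated about `(d^p)⁻¹` times: the distance powers add up to at least 1
per group, the image powers to at most `2^{-k}(1 + C^p)`. -/
theorem exists_le_dist_rpow (hp : 1 ≤ p) (hq : 1 ≤ q) (hF : IsFiniteExhaustion F)
    (h : ReducesSum F S p q) :
    ∃ A > 0, ∀ u ∈ ⋃ n, F n, ∀ v ∈ ⋃ n, F n, dist u v < C →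
      ∀ᶠ j in atTop, A * dist u v ^ p ≤ dist (S j u) (S j v) ^ q := by
  have hq0 : 0 < q := by linarith
  have hp0 : 0 < p := by linarith
  by_contra! hcon
  choose u hu v hv hd hf using fun k : ℕ => hcon ((1 / 2) ^ k) (by positivity)
  have hpos : ∀ k, 0 < dist (u k) (v k) ^ p := fun k => by
    obtain ⟨j, hj⟩ := (hf k).exists
    rcases eq_or_ne (u k) (v k) with he | he
    · simp [he, hq0.ne', hp0.ne'] at hj
    · exact Real.rpow_pos_of_pos (dist_pos.2 he) p
  obtain ⟨ρ, hρ0, hρ, hiff⟩ := h.exists_repeat hp hq hF hu hv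
    (P := fun k t => t < (1 / 2) ^ k * dist (u k) (v k) ^ p) hf
    (fun k => ⌈(dist (u k) (v k) ^ p)⁻¹⌉₊)
  have h₁ := hiff.2 <| by
    refine Summable.of_nonneg_of_le hρ0 (fun i => (hρ i).le) ?_
    refine (summable_of_repeat (f := fun k => (1 / 2) ^ k * dist (u k) (v k) ^ p)
      (fun k => by positivity)).2 ?_
    refine Summable.of_nonneg_of_le (fun k => by positivity) (fun k => ?_)
      ((summable_geometric_two).mul_right (1 + C ^ p))
    have hle := (Nat.ceil_lt_add_one (inv_nonneg.2 (hpos k).le)).le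
    have hCk : dist (u k) (v k) ^ p ≤ C ^ p := Real.rpow_le_rpow dist_nonneg (hd k).le hp0.le
    calc (⌈(dist (u k) (v k) ^ p)⁻¹⌉₊ : ℝ) * ((1 / 2) ^ k * dist (u k) (v k) ^ p)
        ≤ ((dist (u k) (v k) ^ p)⁻¹ + 1) * ((1 / 2) ^ k * dist (u k) (v k) ^ p) :=
          mul_le_mul_of_nonneg_right hle (by positivity)
      _ = (1 / 2) ^ k * (1 + dist (u k) (v k) ^ p) := by
          have := (hpos k).ne'
          field_simp
      _ ≤ (1 / 2) ^ k * (1 + C ^ p) := by gcongr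
  obtain ⟨k, hk⟩ := (h₁.tendsto_atTop_zero.eventually (gt_mem_nhds one_pos)).exists
  exact hk.not_ge ((inv_le_iff_one_le_mul₀ (hpos k)).1 (Nat.le_ceil _))

/-- The estimates concern points of the dense union, so a finite set is first moved there; one large
`j` then serves all of its pairs at once. -/
theorem finitelyHolderEmbeds (hp : 1 ≤ p) (hq : 1 ≤ q) (hF : IsFiniteExhaustion F)
    (h : ReducesSum F S p q) (hC : 0 < C) (hlink : Link X C) :
    FinitelyHolderEmbeds X E C (p / q) := by
  have hq0 : 0 < q := by linarith
  have hp0 : 0 < p := by linarith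
  obtain ⟨A₁, hA₁, hup⟩ := h.exists_dist_rpow_le hp hq hF hlink
  obtain ⟨A₂, hA₂, hlow⟩ := h.exists_le_dist_rpow (C := C) hp hq hF
  -- Pairs at distance at least `C` may drop below `C` when moved, but stay above `C / 2`.
  obtain ⟨D, hD, hsep⟩ := h.exists_le_dist hp hq hF (half_pos hC)
  set B₁ : ℝ := (A₁ * 2 ^ p) ^ (1 / q) with hB₁
  set B₂ : ℝ := (A₂ * (1 / 2) ^ p) ^ (1 / q) with hB₂
  have hB₂0 : 0 < B₂ := by positivity
  refine ⟨max B₁ B₂⁻¹, D, lt_max_of_lt_right (by positivity), hD, fun K => ?_⟩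
  -- The first bound on `η` keeps distances within a factor 2, the second keeps pairs closer than
  -- `C` below `C`.
  have hη : ∀ᶠ η in 𝓝[>] (0 : ℝ), 0 < η ∧ ∀ u v : K, (u ≠ v → η < dist u v / 4) ∧
      (dist u v < C → η < (C - dist u v) / 2) := by
    refine Filter.Eventually.and self_mem_nhdsWithin ?_
    refine eventually_all.2 fun u => eventually_all.2 fun v => Filter.Eventually.and ?_ ?_
    · by_cases huv : u = v
      · simp [huv]
      · have := dist_pos.2 huv
        filter_upwards [nhdsWithin_le_nhds (gt_mem_nhds (show 0 < dist u v / 4 by positivity))]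
          with η hη _ using hη
    · by_cases huv : dist u v < C
      · filter_upwards [nhdsWithin_le_nhds
          (gt_mem_nhds (show 0 < (C - dist u v) / 2 by linarith))] with η hη _ using hη
      · simp [huv]
  obtain ⟨η, hη0, hη⟩ := hη.exists
  choose g hgF hg using fun u : K => hF.dense.exists_dist_lt u.1 hη0
  have hgd : ∀ u v : K, dist (g u) (g v) < dist u v + 2 * η ∧ dist u v - 2 * η < dist (g u) (g v) :=
    fun u v => by
      have h1 := dist_triangle4 (g u) u.1 v.1 (g v)
      have h2 := dist_triangle4 u.1 (g u) (g v) v.1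
      have h3 := hg u
      have h4 := hg v
      have h5 : dist u v = dist u.1 v.1 := rfl
      rw [dist_comm (g u) u.1] at h1
      rw [dist_comm (g v) v.1] at h2
      constructor <;> linarith
  have hj : ∀ᶠ j in atTop, ∀ u v : K,
      (C ≤ dist u v → D ≤ dist (S j (g u)) (S j (g v))) ∧
      (dist u v < C → A₂ * dist (g u) (g v) ^ p ≤ dist (S j (g u)) (S j (g v)) ^ q ∧
        dist (S j (g u)) (S j (g v)) ^ q ≤ A₁ * dist (g u) (g v) ^ p) := by
    refine eventually_all.2 fun u => eventually_all.2 fun v => ?_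
    rcases lt_or_ge (dist u v) C with huv | huv
    · have hlt : dist (g u) (g v) < C := by linarith [(hgd u v).1, (hη u v).2 huv]
      filter_upwards [hup _ (hgF u) _ (hgF v) hlt, hlow _ (hgF u) _ (hgF v) hlt] with j h1 h2
      exact ⟨fun hC' => (hC'.not_gt huv).elim, fun _ => ⟨h2, h1⟩⟩
    · have hne : u ≠ v := by
        rintro rfl
        rw [dist_self] at huv
        linarith
      filter_upwards [hsep, hF.eventually_mem (hgF u), hF.eventually_mem (hgF v)] with j h1 h2 h3
      refine ⟨fun _ => h1 _ h2 _ h3 ?_, fun h' => (huv.not_gt h').elim⟩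
      linarith [(hgd u v).2, (hη u v).1 hne]
  obtain ⟨j, hj⟩ := hj.exists
  refine ⟨fun u => S j (g u), fun u v => ⟨(hj u v).1, fun huv => ?_⟩⟩
  rcases eq_or_ne u v with rfl | hne
  · simp [Real.zero_rpow (div_pos hp0 hq0).ne']
  obtain ⟨h1, h2⟩ := (hj u v).2 huv
  have hlo : 1 / 2 * dist u v ≤ dist (g u) (g v) := by linarith [(hgd u v).2, (hη u v).1 hne]
  have hhi : dist (g u) (g v) ≤ 2 * dist u v := by linarith [(hgd u v).1, (hη u v).1 hne, hη0]
  have root : ∀ {c : ℝ}, 0 ≤ c → (c * dist u v ^ p) ^ (1 / q) = c ^ (1 / q) * dist u v ^ (p / q) :=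
    fun hc => by
      rw [Real.mul_rpow hc (by positivity), ← Real.rpow_mul dist_nonneg, mul_one_div]
  have hS : (dist (S j (g u)) (S j (g v)) ^ q) ^ (1 / q) = dist (S j (g u)) (S j (g v)) := by
    rw [one_div, Real.rpow_rpow_inv dist_nonneg hq0.ne']
  have hlow' : B₂ * dist u v ^ (p / q) ≤ dist (S j (g u)) (S j (g v)) := by
    rw [← hS, hB₂, ← root (by positivity)]
    refine Real.rpow_le_rpow (by positivity) (le_trans ?_ h1) (by positivity)
    rw [mul_assoc, ← Real.mul_rpow (by norm_num) dist_nonneg]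
    gcongr
  have hup' : dist (S j (g u)) (S j (g v)) ≤ B₁ * dist u v ^ (p / q) := by
    rw [← hS, hB₁, ← root (by positivity)]
    refine Real.rpow_le_rpow (by positivity) (h2.trans ?_) (by positivity)
    rw [mul_assoc, ← Real.mul_rpow (by norm_num) dist_nonneg]
    gcongr
  constructor
  · refine le_trans (mul_le_mul_of_nonneg_right ?_ (by positivity)) hlow'
    exact inv_le_of_inv_le₀ hB₂0 (le_max_right _ _)
  · exact hup'.trans (mul_le_mul_of_nonneg_right (le_max_left _ _) (by positivity))

end ReducesSum

/-! ### Sums over blocks and tails. -/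

theorem Real.add_rpow_le_two_rpow_mul {a b q : ℝ} (ha : 0 ≤ a) (hb : 0 ≤ b) (hq : 0 ≤ q) :
    (a + b) ^ q ≤ 2 ^ q * (a ^ q + b ^ q) := by
  have hmax : 0 ≤ max a b := le_max_of_le_left ha
  calc (a + b) ^ q ≤ (2 * max a b) ^ q :=
        Real.rpow_le_rpow (by positivity) (by linarith [le_max_left a b, le_max_right a b]) hq
    _ = 2 ^ q * max a b ^ q := Real.mul_rpow (by norm_num) hmax
    _ ≤ 2 ^ q * (a ^ q + b ^ q) := by
        refine mul_le_mul_of_nonneg_left ?_ (by positivity)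
        rcases max_choice a b with h | h <;> rw [h]
        · exact le_add_of_nonneg_right (by positivity)
        · exact le_add_of_nonneg_left (by positivity)

theorem sum_dist_rpow_triangle {W : ℕ → Type*} [∀ n, PseudoMetricSpace (W n)] {q : ℝ}
    (hq : 0 ≤ q) (s : Finset ℕ) (x y z : ∀ n, W n) :
    ∑ i ∈ s, dist (x i) (z i) ^ q ≤
      2 ^ q * (∑ i ∈ s, dist (x i) (y i) ^ q + ∑ i ∈ s, dist (y i) (z i) ^ q) := by
  rw [← Finset.sum_add_distrib, Finset.mul_sum]
  exact Finset.sum_le_sum fun i _ => (Real.rpow_le_rpow dist_nonneg (dist_triangle _ _ _) hq).trans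
    (Real.add_rpow_le_two_rpow_mul dist_nonneg dist_nonneg hq)

theorem summable_iff_summable_sum_Ico {f : ℕ → ℝ} (hf : ∀ i, 0 ≤ f i) {l : ℕ → ℕ}
    (hl : StrictMono l) :
    Summable f ↔ Summable fun j => ∑ i ∈ Finset.Ico (l j) (l (j + 1)), f i := by
  have hsum : ∀ J, ∑ j ∈ Finset.range J, ∑ i ∈ Finset.Ico (l j) (l (j + 1)), f i =
      ∑ i ∈ Finset.Ico (l 0) (l J), f i := by
    intro J
    induction J with
    | zero => simp
    | succ J ih =>
      rw [Finset.sum_range_succ, ih, Finset.sum_Ico_consecutive _ (hl.monotone (Nat.zero_le J))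
        (hl.monotone J.le_succ)]
  constructor
  · intro h
    refine summable_of_sum_range_le (c := ∑' i, f i)
      (fun j => Finset.sum_nonneg fun i _ => hf i) fun J => ?_
    rw [hsum]
    exact h.sum_le_tsum _ fun i _ => hf i
  · intro h
    refine summable_of_sum_range_le (c := ∑ i ∈ Finset.range (l 0), f i +
      ∑' j, ∑ i ∈ Finset.Ico (l j) (l (j + 1)), f i) hf fun J => ?_
    calc ∑ i ∈ Finset.range J, f i ≤ ∑ i ∈ Finset.range (l J), f i :=
          Finset.sum_le_sum_of_subset_of_nonneg
            (Finset.range_mono hl.le_apply) fun i _ _ => hf i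
      _ = ∑ i ∈ Finset.range (l 0), f i + ∑ i ∈ Finset.Ico (l 0) (l J), f i :=
          (Finset.sum_range_add_sum_Ico _ (hl.monotone (Nat.zero_le J))).symm
      _ ≤ _ := by
          rw [← hsum]
          gcongr
          exact h.sum_le_tsum _ fun j _ => Finset.sum_nonneg fun i _ => hf i

theorem Summable.eventually_sum_Ico_le {f : ℕ → ℝ} (hs : Summable f) (hf : ∀ i, 0 ≤ f i) {ε : ℝ}
    (hε : 0 < ε) : ∀ᶠ k in atTop, ∀ L, ∑ i ∈ Finset.Ico k L, f i ≤ ε := by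
  filter_upwards [(tendsto_sum_nat_add f).eventually (gt_mem_nhds hε)] with k hk L
  rw [Finset.sum_Ico_eq_sum_range]
  simp only [add_comm k]
  exact (((summable_nat_add_iff k).2 hs).sum_le_tsum _ fun i _ => hf _).trans hk.le

/-! ### Baire category and finite modifications of sequences. -/

/-- Countably many Borel sets become simultaneously relatively open on a dense `Gδ` set. -/
theorem exists_dense_open_seq {P : Type*} [TopologicalSpace P] [MeasurableSpace P] [BorelSpace P]
    {ι : Type*} [Countable ι] {B : ι → Set P} (hB : ∀ i, MeasurableSet (B i)) :
    ∃ O : ℕ → Set P, (∀ k, IsOpen (O k) ∧ Dense (O k)) ∧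
      ∀ i, ∃ V, IsOpen V ∧ ∀ x ∈ ⋂ k, O k, x ∈ B i ↔ x ∈ V := by
  choose V hVo hV using fun i => (hB i).residualEq_isOpen
  have hres : {x | ∀ i, x ∈ B i ↔ x ∈ V i} ∈ residual P :=
    eventually_countable_forall.2 fun i => (hV i).mem_iff
  obtain ⟨T, hTo, hTd, hTc, hT⟩ := mem_residual_iff.1 hres
  obtain ⟨O, hO⟩ := (hTc.insert Set.univ).exists_eq_range (Set.insert_nonempty _ _)
  have hmem : ∀ k, O k = Set.univ ∨ O k ∈ T := fun k => by
    have : O k ∈ insert Set.univ T := hO ▸ Set.mem_range_self k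
    simpa using this
  refine ⟨O, fun k => ?_, fun i => ⟨V i, hVo i, fun x hx => hT ?_ i⟩⟩
  · rcases hmem k with h | h
    · rw [h]
      exact ⟨isOpen_univ, dense_univ⟩
    · exact ⟨hTo _ h, hTd _ h⟩
  · intro t ht
    obtain ⟨k, rfl⟩ : t ∈ Set.range O := hO ▸ Set.mem_insert_of_mem _ ht
    exact Set.mem_iInter.1 hx k

/-- The sequence that starts with `u` and continues as `x` from coordinate `m` on. -/
def splice {K : ℕ → Type*} (m : ℕ) (u : ∀ i : Fin m, K i) (x : ∀ i, K i) : ∀ i, K i :=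
  fun i => if h : i < m then u ⟨i, h⟩ else x i

section Splice

variable {K : ℕ → Type*}

theorem splice_of_lt {m : ℕ} (u : ∀ i : Fin m, K i) (x : ∀ i, K i) {i : ℕ} (h : i < m) :
    splice m u x i = u ⟨i, h⟩ := dif_pos h

theorem splice_of_ge {m : ℕ} (u : ∀ i : Fin m, K i) (x : ∀ i, K i) {i : ℕ} (h : m ≤ i) :
    splice m u x i = x i := dif_neg h.not_gt

theorem splice_eq_of_forall_ge {m : ℕ} {x y : ∀ i, K i} (h : ∀ i, m ≤ i → y i = x i) :
    splice m (fun i => x i.1) y = x := by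
  funext i
  rcases lt_or_ge i m with hi | hi
  · rw [splice_of_lt _ _ hi]
  · rw [splice_of_ge _ _ hi, h i hi]

theorem finite_splice_ne_splice (m : ℕ) (u v : ∀ i : Fin m, K i) (x : ∀ i, K i) :
    {i | splice m u x i ≠ splice m v x i}.Finite :=
  (Set.finite_lt_nat m).subset fun i hi => by
    by_contra! h
    have h' : m ≤ i := not_lt.1 h
    exact hi (by rw [splice_of_ge _ _ h', splice_of_ge _ _ h'])

theorem measurable_splice [∀ n, MeasurableSpace (K n)] (m : ℕ) (u : ∀ i : Fin m, K i) :
    Measurable (splice m u) := by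
  refine measurable_pi_lambda _ fun i => ?_
  rcases lt_or_ge i m with hi | hi
  · simp only [splice_of_lt _ _ hi, measurable_const]
  · simpa only [splice_of_ge _ _ hi] using measurable_pi_apply i

variable [∀ n, TopologicalSpace (K n)]

theorem continuous_splice (m : ℕ) (u : ∀ i : Fin m, K i) : Continuous (splice m u) := by
  refine continuous_pi fun i => ?_
  rcases lt_or_ge i m with hi | hi
  · simp only [splice_of_lt _ _ hi, continuous_const]
  · simpa only [splice_of_ge _ _ hi] using continuous_apply i

variable [∀ n, DiscreteTopology (K n)]

theorem IsOpen.eventually_agree_subset {U : Set (∀ n, K n)} (hU : IsOpen U) {a : ∀ n, K n}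
    (ha : a ∈ U) : ∀ᶠ n in atTop, ∀ x : ∀ n, K n, (∀ i < n, x i = a i) → x ∈ U := by
  obtain ⟨_, ⟨b, n, rfl⟩, hab, hbU⟩ :=
    (PiNat.isTopologicalBasis_cylinders K).exists_subset_of_mem_open ha hU
  refine eventually_atTop.2 ⟨n, fun n' hn x hx => hbU ?_⟩
  rw [PiNat.mem_cylinder_iff] at hab ⊢
  exact fun i hi => (hx i (hi.trans_le hn)).trans (hab i hi)

/-- Replacing the first `m` coordinates of a cylinder by `u` leaves a nonempty open set, which meets
`O`; restoring the old coordinates gives a point of the preimage. -/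
theorem Dense.preimage_splice {O : Set (∀ n, K n)} (hO : Dense O) (m : ℕ)
    (u : ∀ i : Fin m, K i) : Dense (splice m u ⁻¹' O) := by
  rw [(PiNat.isTopologicalBasis_cylinders K).dense_iff]
  rintro _ ⟨b, n, rfl⟩ -
  obtain ⟨z, hz, hzO⟩ := hO.inter_open_nonempty _
    (PiNat.isOpen_cylinder K (splice m u b) (max n m)) ⟨_, PiNat.self_mem_cylinder _ _⟩
  rw [PiNat.mem_cylinder_iff] at hz
  refine ⟨splice m (fun i => b i) z, ?_, ?_⟩
  · rw [PiNat.mem_cylinder_iff]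
    intro i hi
    rcases lt_or_ge i m with him | him
    · rw [splice_of_lt _ _ him]
    · rw [splice_of_ge _ _ him, hz i (hi.trans_le (le_max_left _ _)), splice_of_ge _ _ him]
  · have : splice m u (splice m (fun i => b i) z) = z := by
      funext i
      rcases lt_or_ge i m with him | him
      · rw [splice_of_lt _ _ him, hz i (him.trans_le (le_max_right _ _)), splice_of_lt _ _ him]
      · rw [splice_of_ge _ _ him, splice_of_ge _ _ him]
    rwa [Set.mem_preimage, this]

/-- There are only countably many finite beginnings, so Baire's theorem handles all of them
together. -/
theorem exists_forall_splice_mem [∀ n, Finite (K n)] [∀ n, Nonempty (K n)]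
    {O : ℕ → Set (∀ n, K n)} (hO : ∀ k, IsOpen (O k) ∧ Dense (O k)) :
    ∃ a : ∀ n, K n, ∀ m (u : ∀ i : Fin m, K i), splice m u a ∈ ⋂ k, O k := by
  have := dense_iInter_of_isOpen (X := ∀ n, K n)
    (f := fun t : ℕ × (Σ m, ∀ i : Fin m, K i) => splice t.2.1 t.2.2 ⁻¹' O t.1)
    (fun t => (hO t.1).1.preimage (continuous_splice _ _))
    (fun t => (hO t.1).2.preimage_splice _ _)
  obtain ⟨a, ha⟩ := this.nonempty
  exact ⟨a, fun m u => Set.mem_iInter.2 fun k => Set.mem_iInter.1 ha (k, ⟨m, u⟩)⟩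

end Splice

/-! ### Splitting a Borel map into one-coordinate blocks. -/

section Blocks

variable {K W : ℕ → Type*} [∀ n, TopologicalSpace (K n)] [∀ n, DiscreteTopology (K n)]
  [∀ n, Finite (K n)] [∀ n, Nonempty (K n)] [∀ n, MeasurableSpace (K n)] [∀ n, BorelSpace (K n)]
  [∀ n, PseudoMetricSpace (W n)] [∀ n, SecondCountableTopology (W n)]
  [∀ n, MeasurableSpace (W n)] [∀ n, BorelSpace (W n)]

/-- The behaviour of a Borel map `θ` near a generic point `a`: below `l`, the value at a sequence
that follows `a` on `[m, N)` is almost determined by the first `N` coordinates; beyond `l`, it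
almost does not depend on the first `m` coordinates. -/
theorem exists_generic_point {q : ℝ} (hq : 1 ≤ q) {θ : (∀ n, K n) → ∀ n, W n} (hθ : Measurable θ)
    (hfin : ∀ x y, {i | x i ≠ y i}.Finite → Summable fun i => dist (θ x i) (θ y i) ^ q) :
    ∃ (a : ∀ n, K n) (O : ℕ → Set (∀ n, K n)), ∀ m, ∃ l N, m ≤ l ∧ l ≤ N ∧
      (∀ (u v : ∀ i : Fin m, K i), ∀ x ∈ ⋂ k, O k, (∀ i < N, x i = a i) →
        ∀ L, ∑ i ∈ Finset.Ico l L, dist (θ (splice m u x) i) (θ (splice m v x) i) ^ q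
          ≤ (1 / 2) ^ m) ∧
      (∀ (u : ∀ i : Fin m, K i), ∀ x ∈ ⋂ k, O k, (∀ i < N, x i = splice m u a i) →
        ∑ i ∈ Finset.range l, dist (θ x i) (θ (splice m u a) i) ^ q ≤ (1 / 2) ^ m) ∧
      (∀ (u : ∀ i : Fin m, K i) (x : ∀ n, K n), (∀ i < N, x i = splice m u a i) →
        ∀ k ≤ m, x ∈ O k) := by
  have hq0 : 0 < q := by linarith
  -- Bounding all finite partial sums makes this a countable intersection of Borel sets.
  let tail : ∀ m, (∀ i : Fin m, K i) → (∀ i : Fin m, K i) → ℕ → Set (∀ n, K n) := fun m u v k =>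
    {x | ∀ L, ∑ i ∈ Finset.Ico k L, dist (θ (splice m u x) i) (θ (splice m v x) i) ^ q ≤ (1 / 2) ^ m}
  have htail : ∀ m u v k, MeasurableSet (tail m u v k) := fun m u v k => by
    have : tail m u v k = ⋂ L, {x | ∑ i ∈ Finset.Ico k L,
        dist (θ (splice m u x) i) (θ (splice m v x) i) ^ q ≤ (1 / 2) ^ m} := by
      ext x
      simp [tail]
    rw [this]
    refine MeasurableSet.iInter fun L => measurableSet_le ?_ measurable_const
    refine Finset.measurable_sum _ fun i _ => ?_
    have hi : ∀ w : ∀ i : Fin m, K i, Measurable fun x => θ (splice m w x) i := fun w =>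
      (measurable_pi_apply i).comp (hθ.comp (measurable_splice m w))
    exact ((hi u).dist (hi v)).pow_const q
  let b := TopologicalSpace.countableBasis (∀ n, W n)
  have : Countable b := (TopologicalSpace.countable_countableBasis _).to_subtype
  obtain ⟨O, hO, hrel⟩ := exists_dense_open_seq (P := ∀ n, K n)
    (ι := b ⊕ (Σ m, (∀ i : Fin m, K i) × (∀ i : Fin m, K i) × ℕ))
    (B := Sum.elim (fun s => θ ⁻¹' s.1) fun t => tail t.1 t.2.1 t.2.2.1 t.2.2.2) (by
      rintro (s | t)
      · exact hθ (TopologicalSpace.isOpen_of_mem_countableBasis s.2).measurableSet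
      · exact htail _ _ _ _)
  obtain ⟨a, ha⟩ := exists_forall_splice_mem hO
  have ha' : a ∈ ⋂ k, O k := by
    simpa only [splice_eq_of_forall_ge fun i _ => rfl] using ha 0 fun i => a i
  refine ⟨a, O, fun m => ?_⟩
  have hl : ∀ᶠ l in atTop, ∀ u v : ∀ i : Fin m, K i, a ∈ tail m u v l :=
    eventually_all.2 fun u => eventually_all.2 fun v =>
      (hfin _ _ (finite_splice_ne_splice m u v a)).eventually_sum_Ico_le
        (fun i => by positivity) (by positivity)
  obtain ⟨l, hl, hml⟩ := (hl.and (eventually_ge_atTop m)).exists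
  have h₁ : ∀ᶠ N in atTop, ∀ (u v : ∀ i : Fin m, K i), ∀ x : ∀ n, K n, (∀ i < N, x i = a i) →
      x ∈ ⋂ k, O k → x ∈ tail m u v l := by
    refine eventually_all.2 fun u => eventually_all.2 fun v => ?_
    obtain ⟨V, hVo, hV⟩ := hrel (Sum.inr ⟨m, u, v, l⟩)
    filter_upwards [hVo.eventually_agree_subset ((hV a ha').1 (hl u v))] with N hN x hx hxO
    exact (hV x hxO).2 (hN x hx)
  have h₂ : ∀ᶠ N in atTop, ∀ u : ∀ i : Fin m, K i, ∀ x : ∀ n, K n,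
      (∀ i < N, x i = splice m u a i) → x ∈ ⋂ k, O k →
        ∑ i ∈ Finset.range l, dist (θ x i) (θ (splice m u a) i) ^ q < (1 / 2) ^ m := by
    refine eventually_all.2 fun u => ?_
    have hopen : IsOpen {w : ∀ n, W n |
        ∑ i ∈ Finset.range l, dist (w i) (θ (splice m u a) i) ^ q < (1 / 2) ^ m} := by
      refine isOpen_lt (continuous_finsetSum _ fun i _ => ?_) continuous_const
      exact ((continuous_apply i).dist continuous_const).rpow_const fun _ => Or.inr hq0.le
    obtain ⟨s, hs, hsm, hsub⟩ :=
      (TopologicalSpace.isBasis_countableBasis (∀ n, W n)).exists_subset_of_mem_open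
        (show θ (splice m u a) ∈ _ by simp [hq0.ne']) hopen
    obtain ⟨V, hVo, hV⟩ := hrel (Sum.inl ⟨s, hs⟩)
    filter_upwards [hVo.eventually_agree_subset ((hV _ (ha m u)).1 hsm)] with N hN x hx hxO
    exact hsub ((hV x hxO).2 (hN x hx))
  -- This clause later certifies genericity: a sequence following `a` on infinitely many windows
  -- `[m, N)` lies in every `O k`.
  have h₃ : ∀ᶠ N in atTop, ∀ k ∈ Finset.range (m + 1), ∀ u : ∀ i : Fin m, K i, ∀ x : ∀ n, K n,
      (∀ i < N, x i = splice m u a i) → x ∈ O k :=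
    (eventually_all_finset _).2 fun k _ => eventually_all.2 fun u =>
      (hO k).1.eventually_agree_subset (Set.mem_iInter.1 (ha m u) k)
  obtain ⟨N, h₁, h₂, h₃, hN⟩ := (h₁.and (h₂.and (h₃.and (eventually_ge_atTop l)))).exists
  exact ⟨l, N, hml, hN, fun u v x hx hxa => h₁ u v x hxa hx,
    fun u x hx hxa => (h₂ u x hxa hx).le,
    fun u x hx k hk => h₃ k (Finset.mem_range.2 (by omega)) u x hx⟩

/-- On a suitable subproduct, a Borel map that respects finite modifications is, up to a summable
error, a concatenation of maps each of which depends on a single coordinate. -/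
theorem exists_blocks {q : ℝ} (hq : 1 ≤ q) {θ : (∀ n, K n) → ∀ n, W n} (hθ : Measurable θ)
    (hfin : ∀ x y, {i | x i ≠ y i}.Finite → Summable fun i => dist (θ x i) (θ y i) ^ q) :
    ∃ (a : ∀ n, K n) (n l : ℕ → ℕ) (c : ℕ → ℝ), StrictMono n ∧ StrictMono l ∧ Summable c ∧
      ∀ x : ∀ n, K n, (∀ i ∉ Set.range n, x i = a i) → ∀ j,
        ∑ i ∈ Finset.Ico (l j) (l (j + 1)),
          dist (θ x i) (θ (Function.update a (n j) (x (n j))) i) ^ q ≤ c j := by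
  have hq0 : 0 ≤ q := by linarith
  obtain ⟨a, O, h⟩ := exists_generic_point hq hθ hfin
  choose l N hml hlN htail hhead hmem using h
  -- The only free coordinate in `[m j, m (j + 1))` is the last one, `N (m j)`; on the rest of this
  -- window sequences follow `a`.
  let m : ℕ → ℕ := fun j => Nat.rec 0 (fun _ r => N r + 1) j
  have hm : ∀ j, m (j + 1) = N (m j) + 1 := fun j => rfl
  have hmN : ∀ r, r ≤ N r := fun r => (hml r).trans (hlN r)
  have hm_mono : StrictMono m := strictMono_nat_of_lt_succ fun j => by
    have := hmN (m j)
    have := hm j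
    omega
  have hn_mono : StrictMono fun j => N (m j) := strictMono_nat_of_lt_succ fun j => by
    have := hmN (m (j + 1))
    have := hm j
    omega
  have hl_mono : StrictMono fun j => l (m j) := strictMono_nat_of_lt_succ fun j => by
    have := hlN (m j)
    have := hm j
    have := hml (m (j + 1))
    omega
  have hgap : ∀ j i, m j ≤ i → i < N (m j) → i ∉ Set.range fun j => N (m j) := by
    rintro j i hi hi' ⟨k, rfl⟩
    have h₁ : k < j := hn_mono.lt_iff_lt.1 hi'
    have h₂ := hm_mono.monotone (Nat.succ_le_of_lt h₁)
    have := hm k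
    have hi : m j ≤ N (m k) := hi
    simp only [Nat.succ_eq_add_one] at h₂
    omega
  have hgap' : ∀ j i, m j ≤ i → i < m (j + 1) → i ≠ N (m j) →
      i ∉ Set.range fun j => N (m j) := fun j i h₁ h₂ h₃ => by
    rw [hm] at h₂
    exact hgap j i h₁ (by omega)
  have hgen : ∀ x : ∀ n, K n, (∀ i ∉ Set.range fun j => N (m j), x i = a i) → x ∈ ⋂ k, O k := by
    intro x hx
    refine Set.mem_iInter.2 fun k => hmem (m k) (fun i => x i.1) x (fun i hi => ?_) k hm_mono.le_apply
    rcases lt_or_ge i (m k) with him | him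
    · rw [splice_of_lt _ _ him]
    · rw [splice_of_ge _ _ him, hx i (hgap k i him hi)]
  have hsummable : Summable fun j => ((1 : ℝ) / 2) ^ (m j) :=
    summable_geometric_two.comp_injective hm_mono.injective
  refine ⟨a, fun j => N (m j), fun j => l (m j),
    fun j => 2 ^ q * ((1 / 2) ^ m (j + 1) + (1 / 2) ^ m j), hn_mono, hl_mono,
    (((summable_nat_add_iff 1).2 hsummable).add hsummable).mul_left _, fun x hx j => ?_⟩
  set z := Function.update a (N (m j)) (x (N (m j))) with hz
  have hz_ne : ∀ i, i ≠ N (m j) → z i = a i := fun i hi => Function.update_of_ne hi _ _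
  have hzgen : z ∈ ⋂ k, O k := hgen z fun i hi => hz_ne i fun h => hi ⟨j, h.symm⟩
  -- Block `j` lies below `l (m (j + 1))`, where forgetting `x` beyond `m (j + 1)` hardly matters,
  -- and beyond `l (m j)`, where coordinates before `m j` hardly matter. So `y` mediates between `x`
  -- and `z`.
  set y := splice (m (j + 1)) (fun i => x i.1) a with hy
  have hyz : splice (m j) (fun i => x i.1) z = y := by
    funext i
    rcases lt_or_ge i (m j) with hi | hi
    · rw [splice_of_lt _ _ hi, hy, splice_of_lt _ _ (hi.trans (hm_mono j.lt_succ_self))]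
    · rw [splice_of_ge _ _ hi]
      rcases lt_or_ge i (m (j + 1)) with hi' | hi'
      · rw [hy, splice_of_lt _ _ hi']
        rcases eq_or_ne i (N (m j)) with rfl | hne
        · simp [hz]
        · rw [hz_ne i hne, hx i (hgap' j i hi hi' hne)]
      · rw [hy, splice_of_ge _ _ hi']
        refine hz_ne i ?_
        have := hm j
        omega
  have hzz : splice (m j) (fun i => z i.1) z = z := splice_eq_of_forall_ge fun _ _ => rfl
  have h₁ : ∑ i ∈ Finset.Ico (l (m j)) (l (m (j + 1))), dist (θ x i) (θ y i) ^ q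
      ≤ (1 / 2) ^ m (j + 1) := by
    refine le_trans (Finset.sum_le_sum_of_subset_of_nonneg ?_ fun i _ _ => by positivity)
      (hhead (m (j + 1)) (fun i => x i.1) x (hgen x hx) fun i hi => ?_)
    · rw [Finset.range_eq_Ico]
      exact Finset.Ico_subset_Ico_left (Nat.zero_le _)
    · rcases lt_or_ge i (m (j + 1)) with him | him
      · rw [splice_of_lt _ _ him]
      · rw [splice_of_ge _ _ him, hx i (hgap (j + 1) i him hi)]
  have h₂ : ∑ i ∈ Finset.Ico (l (m j)) (l (m (j + 1))), dist (θ y i) (θ z i) ^ q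
      ≤ (1 / 2) ^ m j := by
    have := htail (m j) (fun i => x i.1) (fun i => z i.1) z hzgen
      (fun i hi => hz_ne i hi.ne) (l (m (j + 1)))
    rwa [hyz, hzz] at this
  calc _ ≤ 2 ^ q * (_ + _) := sum_dist_rpow_triangle hq0 _ _ (θ y) _
    _ ≤ _ := mul_le_mul_of_nonneg_left (add_le_add h₁ h₂) (by positivity)

end Blocks

/-! ### From Borel reductions to block maps, and the main theorem. -/

theorem exists_reducesSum_of_borelReducible {X Y : Type*} [MetricSpace X] [MeasurableSpace X]
    [BorelSpace X] [MetricSpace Y] [SecondCountableTopology Y] [MeasurableSpace Y] [BorelSpace Y]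
    {p q : ℝ} (hp : 1 ≤ p) (hq : 1 ≤ q) {F : ℕ → Set X} (hF : IsFiniteExhaustion F)
    {Z : ℕ → Set Y} (h : BorelReducible (ellRel (fun n => F n) hp) (ellRel (fun n => Z n) hq)) :
    ∃ (z : ∀ n, Z n) (n : ℕ → ℕ) (S : ℕ → X → EllSpace (fun n => Z n) z hq),
      StrictMono n ∧ ReducesSum (fun j => F (n j)) S p q := by
  have hp0 : p ≠ 0 := by linarith
  have hq0 : 0 ≤ q := by linarith
  obtain ⟨θ, hθ, hred⟩ := h
  have hred : ∀ x y : ∀ n, F n, (Summable fun n => dist (x n) (y n) ^ p) ↔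
      Summable fun n => dist (θ x n) (θ y n) ^ q := hred
  have : ∀ n, Finite (F n) := hF.finite
  have : ∀ n, Nonempty (F n) := fun n => (hF.nonempty n).to_subtype
  -- Finitely modified sequences are equivalent in the source, so their images are equivalent; this
  -- is the hypothesis of `exists_blocks`.
  obtain ⟨a, n, l, c, hn, hl, hc, hblock⟩ := exists_blocks hq hθ fun x y hxy => by
    refine (hred x y).1 (summable_of_ne_finset_zero (s := hxy.toFinset) fun i hi => ?_)
    have : x i = y i := by simpa using hi
    simp [this, hp0]
  classical
  let pt : ℕ → X → ∀ n, F n := fun j u =>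
    if h : u ∈ F (n j) then Function.update a (n j) ⟨u, h⟩ else a
  refine ⟨θ a, n, fun j u => EllSpace.modify (θ a) hq (Finset.Ico (l j) (l (j + 1))) (θ (pt j u)),
    hn, fun x y hx hy => ?_⟩
  -- Places the entries of `w` at the coordinates `n j` and fills up with the generic point.
  let e : (ℕ → X) → ∀ i, F i := fun w i =>
    if h : (∃ j, n j = i) ∧ Function.extend n w (fun i => (a i).1) i ∈ F i then ⟨_, h.2⟩ else a i
  have he : ∀ w : ℕ → X, (∀ j, w j ∈ F (n j)) → ∀ j, (e w (n j)).1 = w j := fun w hw j => by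
    have : (∃ k, n k = n j) ∧ Function.extend n w (fun i => (a i).1) (n j) ∈ F (n j) :=
      ⟨⟨j, rfl⟩, by rw [hn.injective.extend_apply]; exact hw j⟩
    simp only [e, dif_pos this, hn.injective.extend_apply]
  have he' : ∀ w, ∀ i ∉ Set.range n, e w i = a i := fun w i hi => dif_neg fun h => hi h.1
  have hpt : ∀ w : ℕ → X, (∀ j, w j ∈ F (n j)) → ∀ j,
      Function.update a (n j) (e w (n j)) = pt j (w j) := fun w hw j => by
    simp only [pt, dif_pos (hw j)]
    congr 1
    exact Subtype.ext (he w hw j)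
  have hb : ∀ w : ℕ → X, (∀ j, w j ∈ F (n j)) → ∀ j, ∑ i ∈ Finset.Ico (l j) (l (j + 1)),
      dist (θ (e w) i) (θ (pt j (w j)) i) ^ q ≤ c j := fun w hw j => by
    have := hblock (e w) (he' w) j
    rwa [hpt w hw] at this
  have h₁ : (Summable fun j => dist (x j) (y j) ^ p) ↔
      Summable fun i => dist (e x i) (e y i) ^ p := by
    rw [← hn.injective.summable_iff (f := fun i => dist (e x i) (e y i) ^ p)]
    · simp only [Function.comp_def, Subtype.dist_eq, he x hx, he y hy]
    · intro i hi
      simp [he' _ i hi, hp0]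
  rw [h₁, hred, summable_iff_summable_sum_Ico (fun i => by positivity) hl]
  simp only [EllSpace.dist_modify_rpow]
  have hnn : ∀ (s : Finset ℕ) (w w' : ∀ n, Z n), 0 ≤ ∑ i ∈ s, dist (w i) (w' i) ^ q :=
    fun s w w' => Finset.sum_nonneg fun i _ => by positivity
  have h2 : (0 : ℝ) ≤ 2 ^ q := by positivity
  have hcomm : ∀ (s : Finset ℕ) (w w' : ∀ n, Z n), ∑ i ∈ s, dist (w i) (w' i) ^ q =
      ∑ i ∈ s, dist (w' i) (w i) ^ q := fun s w w' => by simp only [dist_comm]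
  -- Changing both arguments by block errors bounded by the summable `c` does not affect
  -- convergence.
  have hcompare : ∀ (f g f' g' : ℕ → ∀ n, Z n),
      (∀ j, ∑ i ∈ Finset.Ico (l j) (l (j + 1)), dist (f j i) (f' j i) ^ q ≤ c j) →
      (∀ j, ∑ i ∈ Finset.Ico (l j) (l (j + 1)), dist (g' j i) (g j i) ^ q ≤ c j) →
      (Summable fun j => ∑ i ∈ Finset.Ico (l j) (l (j + 1)), dist (f' j i) (g' j i) ^ q) →
      Summable fun j => ∑ i ∈ Finset.Ico (l j) (l (j + 1)), dist (f j i) (g j i) ^ q := by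
    intro f g f' g' hf hg hs
    refine Summable.of_nonneg_of_le (fun j => hnn _ _ _) (fun j => ?_)
      ((hc.add ((hs.add hc).mul_left (2 ^ q))).mul_left (2 ^ q))
    refine (sum_dist_rpow_triangle hq0 _ _ (f' j) _).trans
      (mul_le_mul_of_nonneg_left (add_le_add (hf j) ?_) h2)
    exact (sum_dist_rpow_triangle hq0 _ _ (g' j) _).trans
      (mul_le_mul_of_nonneg_left (add_le_add le_rfl (hg j)) h2)
  constructor
  · refine hcompare _ _ (fun _ => θ (e x)) (fun _ => θ (e y)) (fun j => ?_) (hb y hy)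
    rw [hcomm]
    exact hb x hx j
  · refine hcompare (fun _ => θ (e x)) (fun _ => θ (e y)) _ _ (hb x hx) (fun j => ?_)
    rw [hcomm]
    exact hb y hy j

theorem mainTheorem5 {X Y : Type*}
    [MetricSpace X] [CompleteSpace X] [TopologicalSpace.SeparableSpace X]
    [MeasurableSpace X] [BorelSpace X]
    [MetricSpace Y] [CompleteSpace Y] [TopologicalSpace.SeparableSpace Y]
    [MeasurableSpace Y] [BorelSpace Y]
    {p q : ℝ} (hp : 1 ≤ p) (hq : 1 ≤ q)
    (Yn : ℕ → Set Y) (hYn_borel : ∀ n, MeasurableSet (Yn n)) (hYn_nonempty : (Yn 0).Nonempty)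
    (hYn_mono : Monotone Yn) (hYn_dense : Dense (⋃ n, Yn n))
    {C : ℝ} (hC : 0 < C) (hlink : Link X C)
    (F : ℕ → Set X) (hF : IsFiniteExhaustion F)
    (G : ℕ → Set Y) (hG : IsFiniteExhaustion G) :
    List.TFAE [
      ∃ y : ∀ n, Yn n, FinitelyHolderEmbeds X (EllSpace (fun n => Yn n) y hq) C (p / q),
      BorelReducible (ellRel (fun n => F n) hp) (ellRel (fun n => Yn n) hq),
      BorelReducible (ellRel (fun n => F n) hp) (ellRel (fun n => G n) hq)] := by
  have : SecondCountableTopology Y := UniformSpace.secondCountable_of_separable Y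
  have hα : 0 < p / q := div_pos (by linarith) (by linarith)
  -- No monotonicity or density of `Z` is required, so this serves both (b) and (c).
  have embeds : ∀ {Z : ℕ → Set Y},
      BorelReducible (ellRel (fun n => F n) hp) (ellRel (fun n => Z n) hq) →
      ∃ z : ∀ n, Z n, FinitelyHolderEmbeds X (EllSpace (fun n => Z n) z hq) C (p / q) := by
    intro Z h
    obtain ⟨z, n, S, hn, hS⟩ := exists_reducesSum_of_borelReducible hp hq hF h
    exact ⟨z, hS.finitelyHolderEmbeds hp hq (hF.comp hn) hC hlink⟩
  obtain ⟨y₀, hy₀⟩ := hYn_nonempty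
  choose g hg using hG.nonempty
  tfae_have 1 → 2 := fun ⟨_, h⟩ => borelReducible_of_finitelyHolderEmbeds hp hq hC hF.finite
    hYn_mono h
  tfae_have 2 → 1 := embeds
  tfae_have 1 → 3 := fun ⟨_, h⟩ => borelReducible_of_finitelyHolderEmbeds hp hq hC hF.finite
    hG.mono (h.transfer hq hα hG.mono hG.dense fun n => ⟨g n, hg n⟩)
  tfae_have 3 → 1 := fun h => by
    obtain ⟨_, h⟩ := embeds h
    exact ⟨_, h.transfer hq hα hYn_mono hYn_dense fun n => ⟨y₀, hYn_mono (Nat.zero_le n) hy₀⟩⟩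
  tfae_finish
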